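/- Consider the channel $\mathbf y=\sqrt{\mathsf{snr}}\,\mathbf H\mathbf x+\mathbf n$ with $\mathbf n\sim\mathcal{CN}(\mathbf 0,\mathbf I)$ in $\mathbb C^{n_r}$, a random matrix $\mathbf H\in\mathbb C^{n_r\times n_t}$ known to the receiver, and an input $\mathbf x$ equiprobable on a constellation $\{\mathbf x_1,\dots,\mathbf x_M\}\subset\mathbb C^{n_t}$, $M\ge 2$; input, noise and channel are independent. Let $P_e(\mathsf{snr};\mathbf H)=\Pr(\hat{\mathbf x}_{ML}(\mathbf y)\ne\mathbf x\mid\mathbf H)$ be the error probability of a maximum-likelihood detector and $\bar P_e(\mathsf{snr})=\mathbb E_{\mathbf H}\{P_e(\mathsf{snr};\mathbf H)\}$. For $i\ne j$ put $d_{ij}^2(\mathbf H)=\|\mathbf H\mathbf x_i-\mathbf H\mathbf x_j\|^2$ and assume that $d_{ij}^2(\mathbf H)$ has a probability density $p_{d_{ij}^2}$ on $[0,\infty)$ all of whose derivatives $p^{(n)}_{d_{ij}^2}$, $n=0,1,2,\dots$ (one-sided at $0$), exist and are continuous and integrable on $[0,\infty)$. Let $$P_{e,LB}(\mathsf{snr};\mathbf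 H)=\frac1{M(M-1)}\sum_{i=1}^M\sum_{j\ne i}\tfrac12\operatorname{erfc}\Big(\sqrt{\tfrac{d_{ij}^2(\mathbf H)\,\mathsf{snr}}4}\Big),\qquad P_{e,UB}(\mathsf{snr};\mathbf H)=\frac1{M}\sum_{i=1}^M\sum_{j\ne i}\tfrac12\operatorname{erfc}\Big(\sqrt{\tfrac{d_{ij}^2(\mathbf H)\,\mathsf{snr}}4}\Big),$$ and $\bar P_{e,LB}(\mathsf{snr})=\mathbb E_{\mathbf H}\{P_{e,LB}(\mathsf{snr};\mathbf H)\}$, $\bar P_{e,UB}(\mathsf{snr})=\mathbb E_{\mathbf H}\{P_{e,UB}(\mathsf{snr};\mathbf H)\}$. Then for every $\mathsf{snr}>0$ $$\bar P_{e,LB}(\mathsf{snr})\le\bar P_e(\mathsf{snr})\le\bar P_{e,UB}(\mathsf{snr}),$$ and, for $B\in\{LB,UB\}$ and every $N=0,1,2,\dots$, as $\mathsf{snr}\to\infty$, $$\bar P_{e,B}(\mathsf{snr})=\sum_{n=0}^N\frac1{\mathsf{snr}^{n+1}}\,k''_{B,n+1}\Big(\sum_{i=1}^M\sum_{j\ne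 i}p^{(n)}_{d_{ij}^2}(0)\Big)+O\Big(\frac1{\mathsf{snr}^{N+2}}\Big),$$ where $$k''_{LB,n}=\frac1{2M(M-1)}\frac{4^n}{\sqrt\pi}\frac{\Gamma(n+1/2)}{\Gamma(n+1)},\qquad k''_{UB,n}=\frac1{2M}\frac{4^n}{\sqrt\pi}\frac{\Gamma(n+1/2)}{\Gamma(n+1)}.$$ Moreover, if $\sum_{i}\sum_{j\ne i}p^{(n)}_{d_{ij}^2}(0)\ne0$ for some $n\ge0$, and $d=1+\min\{n\in\mathbb N_0:\sum_{i}\sum_{j\ne i}p^{(n)}_{d_{ij}^2}(0)\ne0\}$, then as $\mathsf{snr}\to\infty$ one has $\bar P_e(\mathsf{snr})=O(\mathsf{snr}^{-d})$ but $\bar P_e(\mathsf{snr})\ne o(\mathsf{snr}^{-d})$, indeed $\bar P_e(\mathsf{snr})=\Theta(\mathsf{snr}^{-d})$, and $d$ is the diversity gain: $$d=-\lim_{\mathsf{snr}\to\infty}\frac{\log\bar P_e(\mathsf{snr})}{\log\mathsf{snr}}.$$ -/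

import Mathlib

open MeasureTheory ProbabilityTheory Filter Topology Asymptotics Set
open scoped Matrix

/-- Complex matrices carry the product (Borel) sigma-algebra of their entries. -/
noncomputable instance MIMO.matrixMeasurableSpace {m n : ℕ} :
    MeasurableSpace (Matrix (Fin m) (Fin n) ℂ) :=
  inferInstanceAs (MeasurableSpace (Fin m → Fin n → ℂ))

noncomputable section

namespace MIMO

/-- The complementary error function. -/
def erfc (z : ℝ) : ℝ :=
  2 / Real.sqrt Real.pi * ∫ t in Ioi z, Real.exp (-t ^ 2)

/-- The squared Euclidean norm of a complex vector. -/
def sqNorm {n : ℕ} (v : Fin n → ℂ) : ℝ := ∑ k, ‖v k‖ ^ 2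

/-- The scalar circularly symmetric complex Gaussian law `CN(0, 1)`: independent real and
imaginary parts, each centred Gaussian with variance `1/2`. -/
def complexGaussian : Measure ℂ :=
  ((gaussianReal 0 (1 / 2)).prod (gaussianReal 0 (1 / 2))).map
    (fun q : ℝ × ℝ => (⟨q.1, q.2⟩ : ℂ))

/-- The noise law `CN(0, I)` on `ℂ ^ n`: independent `CN(0, 1)` entries. -/
def noiseLaw (n : ℕ) : Measure (Fin n → ℂ) := Measure.pi fun _ => complexGaussian

/-- The noiseless receive vector `√snr · H u`. -/
def noiseless {nr nt : ℕ} (snr : ℝ) (h : Matrix (Fin nr) (Fin nt) ℂ) (u : Fin nt → ℂ) :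
    Fin nr → ℂ :=
  ((Real.sqrt snr : ℝ) : ℂ) • (h *ᵥ u)

/-- The likelihood `p(y | u, H)`: the density at `y` of `√snr · H u + n`, `n ∼ CN(0, I)`. -/
def likelihood {nr nt : ℕ} (snr : ℝ) (h : Matrix (Fin nr) (Fin nt) ℂ) (y : Fin nr → ℂ)
    (u : Fin nt → ℂ) : ℝ :=
  ∏ k, (1 / Real.pi) * Real.exp (-‖y k - noiseless snr h u k‖ ^ 2)

/-- `xhat snr h y` is a maximum-likelihood estimate of the transmitted vector from the received
vector `y`, the receiver knowing `snr` and the channel matrix `h`. Ties are broken in any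
measurable way. -/
structure IsMLDetector {nr nt M : ℕ} (x : Fin M → Fin nt → ℂ)
    (xhat : ℝ → Matrix (Fin nr) (Fin nt) ℂ → (Fin nr → ℂ) → (Fin nt → ℂ)) : Prop where
  mem : ∀ snr h y, 0 < snr → xhat snr h y ∈ range x
  max : ∀ snr h y i, 0 < snr →
    likelihood snr h y (x i) ≤ likelihood snr h y (xhat snr h y)
  meas : ∀ snr, 0 < snr →
    Measurable fun q : Matrix (Fin nr) (Fin nt) ℂ × (Fin nr → ℂ) => xhat snr q.1 q.2

/-- The error probability of the detector `xhat` for a fixed channel matrix `h`, when an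
equiprobable symbol `x i` is sent and the noise is independent of it. -/
def errorProb {nr nt M : ℕ} (x : Fin M → Fin nt → ℂ)
    (xhat : ℝ → Matrix (Fin nr) (Fin nt) ℂ → (Fin nr → ℂ) → (Fin nt → ℂ))
    (snr : ℝ) (h : Matrix (Fin nr) (Fin nt) ℂ) : ℝ :=
  ((uniformOn (univ : Set (Fin M))).prod (noiseLaw nr)).real
    {q | xhat snr h (noiseless snr h (x q.1) + q.2) ≠ x q.1}

/-- The squared distance `d_ij²(H)` between the noiseless receive vectors `H x_i`, `H x_j`. -/
def distSq {nr nt M : ℕ} (x : Fin M → Fin nt → ℂ) (i j : Fin M)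
    (h : Matrix (Fin nr) (Fin nt) ℂ) : ℝ :=
  sqNorm (h *ᵥ x i - h *ᵥ x j)

/-- The lower bound to the error probability for a fixed channel matrix. -/
def errorLB {nr nt M : ℕ} (x : Fin M → Fin nt → ℂ) (snr : ℝ)
    (h : Matrix (Fin nr) (Fin nt) ℂ) : ℝ :=
  1 / ((M : ℝ) * ((M : ℝ) - 1)) *
    ∑ i, ∑ j ∈ Finset.univ.filter (fun j => j ≠ i),
      1 / 2 * erfc (Real.sqrt (distSq x i j h * snr / 4))

/-- The upper bound to the error probability for a fixed channel matrix. -/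
def errorUB {nr nt M : ℕ} (x : Fin M → Fin nt → ℂ) (snr : ℝ)
    (h : Matrix (Fin nr) (Fin nt) ℂ) : ℝ :=
  1 / (M : ℝ) *
    ∑ i, ∑ j ∈ Finset.univ.filter (fun j => j ≠ i),
      1 / 2 * erfc (Real.sqrt (distSq x i j h * snr / 4))

/-- The average error probability, over the random channel matrix `H`. -/
def avgErrorProb {Ω : Type*} [MeasurableSpace Ω] (P : Measure Ω) {nr nt M : ℕ}
    (H : Ω → Matrix (Fin nr) (Fin nt) ℂ) (x : Fin M → Fin nt → ℂ)
    (xhat : ℝ → Matrix (Fin nr) (Fin nt) ℂ → (Fin nr → ℂ) → (Fin nt → ℂ)) (snr : ℝ) : ℝ :=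
  ∫ ω, errorProb x xhat snr (H ω) ∂P

/-- The average of the lower bound over the random channel matrix `H`. -/
def avgErrorLB {Ω : Type*} [MeasurableSpace Ω] (P : Measure Ω) {nr nt M : ℕ}
    (H : Ω → Matrix (Fin nr) (Fin nt) ℂ) (x : Fin M → Fin nt → ℂ) (snr : ℝ) : ℝ :=
  ∫ ω, errorLB x snr (H ω) ∂P

/-- The average of the upper bound over the random channel matrix `H`. -/
def avgErrorUB {Ω : Type*} [MeasurableSpace Ω] (P : Measure Ω) {nr nt M : ℕ}
    (H : Ω → Matrix (Fin nr) (Fin nt) ℂ) (x : Fin M → Fin nt → ℂ) (snr : ℝ) : ℝ :=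
  ∫ ω, errorUB x snr (H ω) ∂P

/-- `f` is a probability density on `[0, ∞)` of the random variable `D ≥ 0` all of whose
derivatives on `[0, ∞)` (one-sided at `0`) exist and are continuous and integrable. -/
structure IsSmoothDensity {Ω : Type*} [MeasurableSpace Ω] (P : Measure Ω) (D : Ω → ℝ)
    (f : ℝ → ℝ) : Prop where
  nonneg : ∀ t, 0 ≤ t → 0 ≤ f t
  law : P.map D = (volume.restrict (Ici (0 : ℝ))).withDensity fun t => ENNReal.ofReal (f t)
  smooth : ContDiffOn ℝ (⊤ : ℕ∞) f (Ici 0)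
  integrable : ∀ n : ℕ, IntegrableOn (iteratedDerivWithin n f (Ici 0)) (Ici 0)

/-- The sum over `i ≠ j` of the `n`-th derivatives at `0` of the densities of `d_ij²`. -/
def derivSum {M : ℕ} (p : Fin M → Fin M → ℝ → ℝ) (n : ℕ) : ℝ :=
  ∑ i, ∑ j ∈ Finset.univ.filter (fun j => j ≠ i), iteratedDerivWithin n (p i j) (Ici 0) 0

/-- The constant `k''_LB,n`. -/
def kLB (M n : ℕ) : ℝ :=
  1 / (2 * (M : ℝ) * ((M : ℝ) - 1)) * (4 ^ n / Real.sqrt Real.pi) *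
    (Real.Gamma ((n : ℝ) + 1 / 2) / Real.Gamma ((n : ℝ) + 1))

/-- The constant `k''_UB,n`. -/
def kUB (M n : ℕ) : ℝ :=
  1 / (2 * (M : ℝ)) * (4 ^ n / Real.sqrt Real.pi) *
    (Real.Gamma ((n : ℝ) + 1 / 2) / Real.Gamma ((n : ℝ) + 1))

/-- The parameter `d`: one plus the least order `n` with a nonzero `derivSum` (meaningful when
such an `n` exists). -/
def diversity {M : ℕ} (p : Fin M → Fin M → ℝ → ℝ) : ℕ := 1 + sInf {n : ℕ | derivSum p n ≠ 0}

end MIMO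

end

/-!
# Diversity of maximum-likelihood detection over a random channel

For a fixed channel the likelihood decreases in the distance between the received vector and its
noiseless candidates, so symbol `j` beats symbol `i` exactly when the noise falls in a half-space.
The noise projected on a fixed direction is Gaussian (`MIMO.noiseLaw_map_inner`), which gives this
half-space probability `½ erfc (√(d_ij² snr / 4))` (`MIMO.noiseLaw_real_closer`). The union bound
then yields the upper bound, and averaging the one-rival bound over the `M - 1` rivals of each
symbol yields the lower bound. Both need `d_ij² > 0`, which holds almost surely because `d_ij²` has
a density.

For the expansion, Fubini's theorem turns the averaged pairwise probability into
`π^(-1/2) ∫_{t > 0} exp (-t²) F (4 t² / snr) dt`, with `F` the distribution function of `d_ij²`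
(`MIMO.integral_half_erfc`). The derivatives of the density are bounded, each being an integral of
the next one, so `F` agrees with its Taylor polynomial at `0` up to `C u^(N+2)` on the whole
half-line (`MIMO.IsSmoothDensity.exists_cdf_bound`). Integrating term by term against the Gaussian
weight produces the Gamma factors, and the remainder contributes `O(snr^(-N-2))`.

The two bounds have the same expansion up to positive factors, so both have the exact order of the
first nonvanishing term (`MIMO.isTheta_of_expansion`); the error probability between them has this
order too, and the logarithmic limit follows.
-/

namespace MIMO

/-! ### Complex Gaussian noise -/

instance isProbabilityMeasure_complexGaussian : IsProbabilityMeasure complexGaussian := by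
  unfold complexGaussian
  exact Measure.isProbabilityMeasure_map
    (show Measurable fun q : ℝ × ℝ => (⟨q.1, q.2⟩ : ℂ) from
      Complex.measurableEquivRealProd.symm.measurable).aemeasurable

instance isProbabilityMeasure_noiseLaw (n : ℕ) : IsProbabilityMeasure (noiseLaw n) := by
  unfold noiseLaw
  infer_instance

lemma complexGaussian_map_linear (a b : ℝ) :
    complexGaussian.map (fun z => a * z.re + b * z.im) =
      gaussianReal 0 ((a ^ 2 + b ^ 2) / 2).toNNReal := by
  have hm : Measurable fun q : ℝ × ℝ => (⟨q.1, q.2⟩ : ℂ) :=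
    Complex.measurableEquivRealProd.symm.measurable
  unfold complexGaussian
  rw [Measure.map_map (by fun_prop) hm]
  have hX : ((gaussianReal 0 (1 / 2)).prod (gaussianReal 0 (1 / 2))).map
      (fun q : ℝ × ℝ => a * q.1) = gaussianReal 0 (.mk (a ^ 2) (sq_nonneg _) * (1 / 2)) := by
    rw [show (fun q : ℝ × ℝ => a * q.1) = (fun t => a * t) ∘ Prod.fst from rfl,
      ← Measure.map_map (by fun_prop) (by fun_prop), Measure.map_fst_prod]
    simp [gaussianReal_map_const_mul]
  have hY : ((gaussianReal 0 (1 / 2)).prod (gaussianReal 0 (1 / 2))).map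
      (fun q : ℝ × ℝ => b * q.2) = gaussianReal 0 (.mk (b ^ 2) (sq_nonneg _) * (1 / 2)) := by
    rw [show (fun q : ℝ × ℝ => b * q.2) = (fun t => b * t) ∘ Prod.snd from rfl,
      ← Measure.map_map (by fun_prop) (by fun_prop), Measure.map_snd_prod]
    simp [gaussianReal_map_const_mul]
  have hind := indepFun_prod (μ := gaussianReal 0 (1 / 2)) (ν := gaussianReal 0 (1 / 2))
    (X := fun t => a * t) (Y := fun t => b * t) (by fun_prop) (by fun_prop)
  have h := gaussianReal_add_gaussianReal_of_indepFun hind hX hY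
  have hv : NNReal.mk (a ^ 2) (sq_nonneg _) * (1 / 2) + NNReal.mk (b ^ 2) (sq_nonneg _) * (1 / 2) =
      ((a ^ 2 + b ^ 2) / 2).toNNReal := by
    apply NNReal.eq
    rw [Real.coe_toNNReal _ (by positivity)]
    push_cast
    ring
  rw [add_zero, hv] at h
  exact h

lemma sqNorm_nonneg {n : ℕ} (v : Fin n → ℂ) : 0 ≤ sqNorm v :=
  Finset.sum_nonneg fun _ _ => by positivity

@[fun_prop]
lemma measurable_sqNorm {n : ℕ} : Measurable (sqNorm (n := n)) := by
  unfold sqNorm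
  fun_prop

/-- The noise is rotationally invariant: its real inner product with a vector `δ` is centred
Gaussian of variance `‖δ‖² / 2`. -/
lemma noiseLaw_map_inner {n : ℕ} (δ : Fin n → ℂ) :
    (noiseLaw n).map (fun v => ∑ k, ((δ k).re * (v k).re + (δ k).im * (v k).im)) =
      gaussianReal 0 (sqNorm δ / 2).toNNReal := by
  apply Measure.ext_of_charFun
  have hind := iIndepFun_pi (μ := fun _ : Fin n => complexGaussian)
    (X := fun k z => (δ k).re * z.re + (δ k).im * z.im) (fun k => by fun_prop)
  rw [noiseLaw, iIndepFun.charFun_map_fun_sum_eq_prod (fun k => by fun_prop) hind]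
  ext t
  have hk : ∀ k : Fin n, (Measure.pi fun _ : Fin n => complexGaussian).map
      (fun v => (δ k).re * (v k).re + (δ k).im * (v k).im) =
      gaussianReal 0 (‖δ k‖ ^ 2 / 2).toNNReal := by
    intro k
    rw [show (fun v : Fin n → ℂ => (δ k).re * (v k).re + (δ k).im * (v k).im) =
        (fun z : ℂ => (δ k).re * z.re + (δ k).im * z.im) ∘ Function.eval k from rfl,
      ← Measure.map_map (by fun_prop) (by fun_prop), Measure.pi_map_eval]
    simp only [measure_univ, Finset.prod_const_one, one_smul]
    rw [complexGaussian_map_linear, Complex.sq_norm, Complex.normSq_apply]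
    congr 3
    ring
  simp only [Finset.prod_apply, hk, charFun_gaussianReal]
  rw [← Complex.exp_sum]
  congr 1
  rw [Real.coe_toNNReal _ (by have := sqNorm_nonneg δ; positivity)]
  simp only [Real.coe_toNNReal _ (show (0 : ℝ) ≤ ‖δ _‖ ^ 2 / 2 by positivity)]
  unfold sqNorm
  push_cast
  simp only [mul_zero, zero_mul, zero_sub, Finset.sum_neg_distrib, Finset.sum_div,
    Finset.sum_mul]

lemma gaussianReal_real_Ioi_eq_erfc {c : ℝ} (hc : 0 < c) :
    (gaussianReal 0 (c ^ 2 / 2).toNNReal).real (Ioi (c ^ 2 / 2)) = 1 / 2 * erfc (c / 2) := by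
  have hv : (c ^ 2 / 2).toNNReal ≠ 0 := by
    simpa using pow_pos hc 2
  rw [measureReal_def, gaussianReal_apply_eq_integral _ hv, ENNReal.toReal_ofReal
    (integral_nonneg fun _ => gaussianPDFReal_nonneg _ _ _)]
  have h := integral_comp_mul_left_Ioi
    (fun t => gaussianPDFReal 0 (c ^ 2 / 2).toNNReal t) (c / 2) hc
  rw [show c * (c / 2) = c ^ 2 / 2 by ring, smul_eq_mul, inv_mul_eq_div, eq_div_iff hc.ne'] at h
  rw [← h, erfc, ← integral_const_mul, ← integral_const_mul, ← integral_mul_const]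
  refine setIntegral_congr_fun measurableSet_Ioi fun t _ => ?_
  simp only [gaussianPDFReal, Real.coe_toNNReal _ (show (0 : ℝ) ≤ c ^ 2 / 2 by positivity)]
  rw [show 2 * Real.pi * (c ^ 2 / 2) = Real.pi * c ^ 2 by ring,
    Real.sqrt_mul Real.pi_pos.le, Real.sqrt_sq hc.le,
    show -(c * t - 0) ^ 2 / (2 * (c ^ 2 / 2)) = -t ^ 2 by field_simp; ring]
  field_simp

/-- Both half-spaces, open and closed, of the points nearer to `-δ` than to `0` have noise
probability `½ erfc (‖δ‖ / 2)`: the common value is the pairwise error probability. -/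
lemma noiseLaw_real_closer {n : ℕ} {δ : Fin n → ℂ} (hδ : 0 < sqNorm δ) :
    (noiseLaw n).real {v | sqNorm (v + δ) < sqNorm v} = 1 / 2 * erfc (√(sqNorm δ / 4)) ∧
      (noiseLaw n).real {v | sqNorm (v + δ) ≤ sqNorm v} = 1 / 2 * erfc (√(sqNorm δ / 4)) := by
  set L : (Fin n → ℂ) → ℝ := fun v => ∑ k, (((-δ) k).re * (v k).re + ((-δ) k).im * (v k).im)
    with hL
  have hLm : Measurable L := by fun_prop
  have hneg : sqNorm (-δ) = sqNorm δ := by simp [sqNorm]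
  have hmap : (noiseLaw n).map L = gaussianReal 0 (sqNorm δ / 2).toNNReal := by
    rw [hL, noiseLaw_map_inner, hneg]
  have hexp : ∀ v, sqNorm (v + δ) = sqNorm v - 2 * L v + sqNorm δ := by
    intro v
    simp only [sqNorm, hL, Finset.mul_sum, ← Finset.sum_sub_distrib, ← Finset.sum_add_distrib]
    refine Finset.sum_congr rfl fun k _ => ?_
    simp only [Complex.sq_norm, Complex.normSq_apply, Pi.add_apply, Pi.neg_apply, Complex.add_re,
      Complex.add_im, Complex.neg_re, Complex.neg_im]
    ring
  have h1 : {v | sqNorm (v + δ) < sqNorm v} = L ⁻¹' Ioi (sqNorm δ / 2) := by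
    ext v
    simp only [mem_ofPred_eq, hexp, mem_preimage, mem_Ioi]
    constructor <;> intro h <;> linarith
  have h2 : {v | sqNorm (v + δ) ≤ sqNorm v} = L ⁻¹' Ici (sqNorm δ / 2) := by
    ext v
    simp only [mem_ofPred_eq, hexp, mem_preimage, mem_Ici]
    constructor <;> intro h <;> linarith
  have hc : 0 < √(sqNorm δ) := Real.sqrt_pos.2 hδ
  have hcsq : √(sqNorm δ) ^ 2 = sqNorm δ := Real.sq_sqrt hδ.le
  have hval := gaussianReal_real_Ioi_eq_erfc hc
  rw [hcsq] at hval
  have h4 : √(sqNorm δ / 4) = √(sqNorm δ) / 2 := by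
    rw [Real.sqrt_div hδ.le, show (4 : ℝ) = 2 ^ 2 by norm_num, Real.sqrt_sq (by norm_num)]
  have hv : (sqNorm δ / 2).toNNReal ≠ 0 := by simpa using hδ
  have := nullSingletonClass_gaussianReal (μ := 0) hv
  rw [h1, h2, h4, ← hval, ← map_measureReal_apply hLm measurableSet_Ioi,
    ← map_measureReal_apply hLm measurableSet_Ici, hmap]
  exact ⟨rfl, measureReal_congr Ioi_ae_eq_Ici.symm⟩

/-! ### Pairwise bounds for the error probability -/

lemma likelihood_eq {nr nt : ℕ} (snr : ℝ) (h : Matrix (Fin nr) (Fin nt) ℂ) (y : Fin nr → ℂ)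
    (u : Fin nt → ℂ) :
    likelihood snr h y u =
      (1 / Real.pi) ^ nr * Real.exp (-sqNorm (y - noiseless snr h u)) := by
  simp [likelihood, sqNorm, Finset.prod_mul_distrib, Real.exp_sum, ← Finset.sum_neg_distrib]

lemma likelihood_le_iff {nr nt : ℕ} (snr : ℝ) (h : Matrix (Fin nr) (Fin nt) ℂ) (y : Fin nr → ℂ)
    (u w : Fin nt → ℂ) :
    likelihood snr h y u ≤ likelihood snr h y w ↔
      sqNorm (y - noiseless snr h w) ≤ sqNorm (y - noiseless snr h u) := by
  rw [likelihood_eq, likelihood_eq, mul_le_mul_iff_right₀ (by positivity), Real.exp_le_exp,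
    neg_le_neg_iff]

lemma sqNorm_noiseless_sub {nr nt M : ℕ} (x : Fin M → Fin nt → ℂ) {snr : ℝ} (hs : 0 < snr)
    (h : Matrix (Fin nr) (Fin nt) ℂ) (i j : Fin M) :
    sqNorm (noiseless snr h (x i) - noiseless snr h (x j)) = distSq x i j h * snr := by
  simp only [noiseless, ← smul_sub, distSq, sqNorm, Finset.sum_mul, Pi.smul_apply, smul_eq_mul,
    norm_mul, Complex.norm_real, Real.norm_eq_abs, mul_pow, sq_abs, Real.sq_sqrt hs.le]
  exact Finset.sum_congr rfl fun k _ => mul_comm _ _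

lemma measurable_mulVec {nr nt : ℕ} (u : Fin nt → ℂ) :
    Measurable fun h : Matrix (Fin nr) (Fin nt) ℂ => h *ᵥ u := by
  have hentry : ∀ k l, Measurable fun h : Matrix (Fin nr) (Fin nt) ℂ => h k l := fun k l =>
    (measurable_pi_apply l).comp (measurable_pi_apply (X := fun _ : Fin nr => Fin nt → ℂ) k)
  refine measurable_pi_lambda _ fun k => ?_
  simp only [Matrix.mulVec, dotProduct]
  exact Finset.measurable_sum _ fun l _ => (hentry k l).mul_const _

lemma measurable_distSq {nr nt M : ℕ} (x : Fin M → Fin nt → ℂ) (i j : Fin M) :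
    Measurable (distSq (nr := nr) x i j) :=
  measurable_sqNorm.comp ((measurable_mulVec (x i)).sub (measurable_mulVec (x j)))

/-- The event, as a set of noise vectors, that the detector errs when symbol `i` is sent. -/
def errorEvent {nr nt M : ℕ} (x : Fin M → Fin nt → ℂ)
    (xhat : ℝ → Matrix (Fin nr) (Fin nt) ℂ → (Fin nr → ℂ) → (Fin nt → ℂ))
    (snr : ℝ) (h : Matrix (Fin nr) (Fin nt) ℂ) (i : Fin M) : Set (Fin nr → ℂ) :=
  {v | xhat snr h (noiseless snr h (x i) + v) ≠ x i}

section Detector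

variable {nr nt M : ℕ} {x : Fin M → Fin nt → ℂ}
  {xhat : ℝ → Matrix (Fin nr) (Fin nt) ℂ → (Fin nr → ℂ) → (Fin nt → ℂ)}

lemma measurableSet_errorEvent_prod (hx : IsMLDetector x xhat) {snr : ℝ} (hs : 0 < snr)
    (i : Fin M) :
    MeasurableSet {q : Matrix (Fin nr) (Fin nt) ℂ × (Fin nr → ℂ) |
      q.2 ∈ errorEvent x xhat snr q.1 i} := by
  have hn : Measurable fun h : Matrix (Fin nr) (Fin nt) ℂ => noiseless snr h (x i) :=
    (measurable_mulVec (x i)).const_smul ((√snr : ℝ) : ℂ)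
  have hm : Measurable fun q : Matrix (Fin nr) (Fin nt) ℂ × (Fin nr → ℂ) =>
      xhat snr q.1 (noiseless snr q.1 (x i) + q.2) :=
    (hx.meas snr hs).comp (measurable_fst.prodMk ((hn.comp measurable_fst).add measurable_snd))
  exact (hm (measurableSet_singleton (x i))).compl

lemma measurableSet_errorEvent (hx : IsMLDetector x xhat) {snr : ℝ} (hs : 0 < snr)
    (h : Matrix (Fin nr) (Fin nt) ℂ) (i : Fin M) :
    MeasurableSet (errorEvent x xhat snr h i) :=
  measurable_prodMk_left (measurableSet_errorEvent_prod hx hs i)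

lemma errorProb_eq_sum (hx : IsMLDetector x xhat) {snr : ℝ} (hs : 0 < snr)
    (h : Matrix (Fin nr) (Fin nt) ℂ) :
    errorProb x xhat snr h =
      1 / (M : ℝ) * ∑ i, (noiseLaw nr).real (errorEvent x xhat snr h i) := by
  set E : Set (Fin M × (Fin nr → ℂ)) :=
    {q | xhat snr h (noiseless snr h (x q.1) + q.2) ≠ x q.1} with hE
  have hEU : E = ⋃ i : Fin M, {i} ×ˢ errorEvent x xhat snr h i := by
    ext q
    simp [hE, errorEvent]
  have hdisj : Pairwise fun i j : Fin M => Disjoint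
      (({i} : Set (Fin M)) ×ˢ errorEvent x xhat snr h i)
      (({j} : Set (Fin M)) ×ˢ errorEvent x xhat snr h j) := fun i j hij =>
    Set.disjoint_prod.2 (Or.inl (by simpa using hij))
  have hmeas : ∀ i : Fin M, MeasurableSet (({i} : Set (Fin M)) ×ˢ errorEvent x xhat snr h i) :=
    fun i => (measurableSet_singleton i).prod (measurableSet_errorEvent hx hs h i)
  have hsing : ∀ i : Fin M, (uniformOn (univ : Set (Fin M))).real {i} = 1 / (M : ℝ) := by
    intro i
    simp [measureReal_def, uniformOn_univ]
  rw [errorProb, ← hE, hEU, measureReal_iUnion_fintype hdisj hmeas, Finset.mul_sum]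
  refine Finset.sum_congr rfl fun i _ => ?_
  rw [measureReal_prod_prod, hsing]

lemma errorProb_nonneg (snr : ℝ) (h : Matrix (Fin nr) (Fin nt) ℂ) :
    0 ≤ errorProb x xhat snr h := measureReal_nonneg

lemma measurable_errorProb (hx : IsMLDetector x xhat) {snr : ℝ} (hs : 0 < snr) :
    Measurable (errorProb x xhat snr) := by
  rw [show errorProb x xhat snr = _ from funext fun h => errorProb_eq_sum hx hs h]
  refine (Finset.measurable_sum _ fun i _ => ?_).const_mul _
  exact (measurable_measure_prodMk_left (measurableSet_errorEvent_prod hx hs i)).ennreal_toReal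

variable {snr : ℝ} {h : Matrix (Fin nr) (Fin nt) ℂ} {i j : Fin M}

/-- An error is certain as soon as another symbol is strictly more likely. -/
lemma le_noiseLaw_errorEvent (hx : IsMLDetector x xhat) (hs : 0 < snr)
    (hd : 0 < distSq x i j h) :
    1 / 2 * erfc (√(distSq x i j h * snr / 4)) ≤
      (noiseLaw nr).real (errorEvent x xhat snr h i) := by
  have hδ := sqNorm_noiseless_sub x hs h i j
  rw [← hδ, ← (noiseLaw_real_closer (hδ ▸ mul_pos hd hs)).1]
  refine measureReal_mono fun v hv hvi => ?_
  have hmax := hx.max snr h (noiseless snr h (x i) + v) j hs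
  rw [hvi, likelihood_le_iff, add_sub_cancel_left, add_sub_right_comm, add_comm _ v] at hmax
  exact absurd hv (not_lt.2 hmax)

/-- The union bound over the wrong symbols. -/
lemma noiseLaw_errorEvent_le (hx : IsMLDetector x xhat) (hs : 0 < snr)
    (hd : ∀ j, j ≠ i → 0 < distSq x i j h) :
    (noiseLaw nr).real (errorEvent x xhat snr h i) ≤
      ∑ j ∈ Finset.univ.filter (fun j => j ≠ i),
        1 / 2 * erfc (√(distSq x i j h * snr / 4)) := by
  have hsub : errorEvent x xhat snr h i ⊆ ⋃ j ∈ Finset.univ.filter (fun j => j ≠ i),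
      {v | sqNorm (v + (noiseless snr h (x i) - noiseless snr h (x j))) ≤ sqNorm v} := by
    intro v hv
    obtain ⟨j, hj⟩ := hx.mem snr h (noiseless snr h (x i) + v) hs
    have hji : j ≠ i := fun e => hv (by rw [← hj, e])
    have hmax := hx.max snr h (noiseless snr h (x i) + v) i hs
    rw [← hj, likelihood_le_iff, add_sub_cancel_left, add_sub_right_comm, add_comm _ v] at hmax
    simp only [mem_iUnion, Finset.mem_filter, Finset.mem_univ, true_and]
    exact ⟨j, hji, hmax⟩
  refine (measureReal_mono hsub (measure_ne_top _ _)).trans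
    ((measureReal_biUnion_finset_le _ _).trans ?_)
  refine Finset.sum_le_sum fun j hj => ?_
  have hδ := sqNorm_noiseless_sub x hs h i j
  rw [← hδ]
  refine (noiseLaw_real_closer (hδ ▸ mul_pos (hd j ?_) hs)).2.le
  simpa using hj

lemma errorLB_le_errorProb (hx : IsMLDetector x xhat) (hM : 2 ≤ M) (hs : 0 < snr)
    (hd : ∀ i j, i ≠ j → 0 < distSq x i j h) :
    errorLB x snr h ≤ errorProb x xhat snr h := by
  have hM2 : (2 : ℝ) ≤ M := by exact_mod_cast hM
  have hM1 : (0 : ℝ) < M - 1 := by linarith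
  rw [errorProb_eq_sum hx hs, errorLB, one_div_mul_eq_div, one_div_mul_eq_div, ← div_div,
    div_right_comm, div_le_div_iff_of_pos_right (by linarith), Finset.sum_div]
  refine Finset.sum_le_sum fun i _ => ?_
  rw [div_le_iff₀ hM1]
  -- The bound for `i` holds for each of the `M - 1` rivals `j`, hence for their average.
  refine (Finset.sum_le_card_nsmul _ _ _ fun j hj =>
    le_noiseLaw_errorEvent hx hs (hd i j ?_)).trans_eq ?_
  · exact (by simpa using hj : j ≠ i).symm
  · have hcard : (Finset.univ.filter (fun j : Fin M => j ≠ i)).card = M - 1 := by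
      simp [Finset.filter_ne']
    rw [hcard, nsmul_eq_mul, Nat.cast_sub (by omega), Nat.cast_one, mul_comm]

lemma errorProb_le_errorUB (hx : IsMLDetector x xhat) (hs : 0 < snr)
    (hd : ∀ i j, i ≠ j → 0 < distSq x i j h) :
    errorProb x xhat snr h ≤ errorUB x snr h := by
  rw [errorProb_eq_sum hx hs, errorUB]
  gcongr with i
  exact noiseLaw_errorEvent_le hx hs fun j hj => hd i j hj.symm

end Detector

end MIMO

namespace MIMO

/-! ### Expansion of a smooth density at the origin -/

section Density

variable {Ω : Type*} [MeasurableSpace Ω] {P : Measure Ω} {D : Ω → ℝ} {f : ℝ → ℝ}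

/-- Each derivative of the density is bounded, because the next one is integrable. -/
lemma IsSmoothDensity.exists_bound (hf : IsSmoothDensity P D f) (n : ℕ) :
    ∃ C, ∀ t, 0 ≤ t → |iteratedDerivWithin n f (Ici 0) t| ≤ C := by
  set g := iteratedDerivWithin n f (Ici (0 : ℝ)) with hg
  set g' := iteratedDerivWithin (n + 1) f (Ici (0 : ℝ)) with hg'
  have hU : UniqueDiffOn ℝ (Ici (0 : ℝ)) := uniqueDiffOn_Ici 0
  have hdiff : DifferentiableOn ℝ g (Ici 0) :=
    hf.smooth.differentiableOn_iteratedDerivWithin (by exact_mod_cast WithTop.coe_lt_top _) hU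
  have hderiv : ∀ t, 0 < t → HasDerivAt g (g' t) t := by
    intro t ht
    rw [hg', iteratedDerivWithin_succ]
    exact (hdiff t ht.le).hasDerivWithinAt.hasDerivAt (Ici_mem_nhds ht)
  have hint : IntegrableOn g' (Ici 0) := hf.integrable (n + 1)
  refine ⟨|g 0| + ∫ t in Ici (0 : ℝ), |g' t|, fun t ht => ?_⟩
  have hFTC : ∫ u in (0 : ℝ)..t, g' u = g t - g 0 :=
    intervalIntegral.integral_eq_sub_of_hasDerivAt_of_le ht
      (hdiff.continuousOn.mono Icc_subset_Ici_self) (fun u hu => hderiv u hu.1)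
      ((intervalIntegrable_iff_integrableOn_Ioc_of_le ht).2
        (hint.mono_set (Ioc_subset_Icc_self.trans Icc_subset_Ici_self)))
  have hle : |∫ u in (0 : ℝ)..t, g' u| ≤ ∫ u in Ici (0 : ℝ), |g' u| := by
    rw [intervalIntegral.integral_of_le ht]
    exact (abs_integral_le_integral_abs).trans
      (setIntegral_mono_set hint.abs (ae_of_all _ fun _ => abs_nonneg _)
        (Ioc_subset_Icc_self.trans Icc_subset_Ici_self).eventuallyLE)
  rw [hFTC] at hle
  have := abs_sub_abs_le_abs_sub (g t) (g 0)
  linarith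

/-- Taylor's formula at `0`, with a remainder bound uniform over the whole half-line. -/
lemma IsSmoothDensity.exists_taylor_bound (hf : IsSmoothDensity P D f) (N : ℕ) :
    ∃ C, ∀ t, 0 ≤ t →
      |f t - ∑ n ∈ Finset.range (N + 1),
        iteratedDerivWithin n f (Ici 0) 0 / n.factorial * t ^ n| ≤ C * t ^ (N + 1) := by
  obtain ⟨C, hC⟩ := hf.exists_bound (N + 1)
  refine ⟨C / N.factorial, fun t ht => ?_⟩
  -- The interval is enlarged so that it is nondegenerate also for `t = 0`.
  have hI : ∀ n, ∀ u ∈ Icc 0 (t + 1),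
      iteratedDerivWithin n f (Icc 0 (t + 1)) u = iteratedDerivWithin n f (Ici 0) u := by
    intro n u hu
    simp only [iteratedDerivWithin]
    rw [iteratedFDerivWithin_subset Icc_subset_Ici_self (uniqueDiffOn_Icc (by linarith))
      (uniqueDiffOn_Ici 0) (hf.smooth.of_le (by exact_mod_cast le_top)) hu]
  have h := taylor_mean_remainder_bound (n := N) (x := t) (a := 0) (b := t + 1) (C := C)
    (by linarith) ((hf.smooth.mono Icc_subset_Ici_self).of_le (by exact_mod_cast le_top))
    ⟨ht, by linarith⟩ (fun u hu => by rw [hI _ u hu]; exact hC u hu.1)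
  rw [taylor_within_apply, Real.norm_eq_abs, sub_zero] at h
  convert h using 1
  · congr 2
    refine Finset.sum_congr rfl fun n _ => ?_
    rw [hI n 0 ⟨le_rfl, by linarith⟩, smul_eq_mul]
    ring
  · ring

lemma IsSmoothDensity.measureReal_lt (hf : IsSmoothDensity P D f) (hD : Measurable D) {u : ℝ}
    (hu : 0 ≤ u) : P.real {ω | D ω < u} = ∫ t in (0 : ℝ)..u, f t := by
  have h0 : IntegrableOn f (Ici 0) := by simpa using hf.integrable 0
  have h1 : P.real {ω | D ω < u} = (P.map D).real (Iio u) :=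
    (map_measureReal_apply hD measurableSet_Iio).symm
  rw [h1, hf.law, measureReal_def, withDensity_apply _ measurableSet_Iio,
    Measure.restrict_restrict measurableSet_Iio, inter_comm, Ici_inter_Iio,
    ← ofReal_integral_eq_lintegral_ofReal (h0.mono_set Ico_subset_Ici_self)
      ((ae_restrict_iff' measurableSet_Ico).2 (ae_of_all _ fun t ht => hf.nonneg t ht.1)),
    ENNReal.toReal_ofReal (setIntegral_nonneg measurableSet_Ico fun t ht => hf.nonneg t ht.1),
    intervalIntegral.integral_of_le hu, integral_Ico_eq_integral_Ioc]

lemma IsSmoothDensity.ae_pos (hf : IsSmoothDensity P D f) (hD : Measurable D) :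
    ∀ᵐ ω ∂P, 0 < D ω := by
  have h : (P.map D) (Iic 0) = 0 := by
    rw [hf.law, withDensity_apply _ measurableSet_Iic, Measure.restrict_restrict measurableSet_Iic,
      inter_comm, Ici_inter_Iic, Icc_self, Measure.restrict_eq_zero.2 Real.volume_singleton,
      lintegral_zero_measure]
  rw [Measure.map_apply hD measurableSet_Iic] at h
  rw [ae_iff]
  simp only [not_lt]
  exact h

/-- The expansion of the distribution function, obtained by integrating that of the density. -/
lemma IsSmoothDensity.exists_cdf_bound (hf : IsSmoothDensity P D f) (hD : Measurable D) (N : ℕ) :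
    ∃ C, ∀ u, 0 ≤ u →
      |P.real {ω | D ω < u} - ∑ n ∈ Finset.range (N + 1),
        iteratedDerivWithin n f (Ici 0) 0 / (n + 1).factorial * u ^ (n + 1)| ≤
          C * u ^ (N + 2) := by
  obtain ⟨C, hC⟩ := hf.exists_taylor_bound N
  refine ⟨C / (N + 2), fun u hu => ?_⟩
  have h0 : IntervalIntegrable f volume 0 u := by
    refine (intervalIntegrable_iff_integrableOn_Ioc_of_le hu).2 ?_
    have := hf.integrable 0
    rw [iteratedDerivWithin_zero] at this
    exact this.mono_set (Ioc_subset_Icc_self.trans Icc_subset_Ici_self)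
  have hpoly : ∑ n ∈ Finset.range (N + 1),
      iteratedDerivWithin n f (Ici 0) 0 / (n + 1).factorial * u ^ (n + 1) =
      ∫ t in (0 : ℝ)..u, ∑ n ∈ Finset.range (N + 1),
        iteratedDerivWithin n f (Ici 0) 0 / n.factorial * t ^ n := by
    rw [intervalIntegral.integral_finsetSum
      fun n _ => Continuous.intervalIntegrable (by fun_prop) _ _]
    refine Finset.sum_congr rfl fun n _ => ?_
    rw [intervalIntegral.integral_const_mul, integral_pow, Nat.factorial_succ]
    push_cast
    field_simp
    simp
  rw [hf.measureReal_lt hD hu, hpoly, ← intervalIntegral.integral_sub h0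
    (Continuous.intervalIntegrable (by fun_prop) _ _), ← Real.norm_eq_abs]
  refine (intervalIntegral.norm_integral_le_of_norm_le hu (g := fun t => C * t ^ (N + 1))
    (ae_of_all _ fun t ht => hC t ht.1.le)
    (Continuous.intervalIntegrable (by fun_prop) _ _)).trans_eq ?_
  rw [intervalIntegral.integral_const_mul, integral_pow]
  push_cast
  ring

/-! ### Averaging the pairwise error probability -/

/-- The Gaussian moments on the half-line, scaled as they occur in the expansion. -/
lemma integral_gaussian_moment (m : ℕ) (s : ℝ) :
    IntegrableOn (fun t : ℝ => Real.exp (-t ^ 2) * (4 * t ^ 2 / s) ^ m) (Ioi 0) ∧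
    ∫ t in Ioi (0 : ℝ), Real.exp (-t ^ 2) * (4 * t ^ 2 / s) ^ m =
      4 ^ m / s ^ m * (Real.Gamma (m + 1 / 2) / 2) := by
  have heq : (fun t : ℝ => Real.exp (-t ^ 2) * (4 * t ^ 2 / s) ^ m) =
      fun t : ℝ => 4 ^ m / s ^ m * (t ^ (((2 * m : ℕ) : ℝ)) * Real.exp (-t ^ (2 : ℝ))) := by
    ext t
    rw [Real.rpow_natCast, Real.rpow_two, div_pow, mul_pow, ← pow_mul]
    ring
  have hm : (-1 : ℝ) < ((2 * m : ℕ) : ℝ) := by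
    have : (0 : ℝ) ≤ ((2 * m : ℕ) : ℝ) := by positivity
    linarith
  rw [heq]
  constructor
  · refine Integrable.const_mul ?_ _
    simpa [IntegrableOn] using integrableOn_rpow_mul_exp_neg_mul_sq one_pos hm
  · rw [integral_const_mul, integral_rpow_mul_exp_neg_rpow (by norm_num) hm]
    congr 1
    rw [show (((2 * m : ℕ) : ℝ) + 1) / 2 = m + 1 / 2 by push_cast; ring]
    ring

lemma integrable_erfc_kernel [IsProbabilityMeasure P] (hD : Measurable D) (s : ℝ) :
    Integrable (fun q : Ω × ℝ => (Ioi (√(D q.1 * s / 4))).indicator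
      (fun t => Real.exp (-t ^ 2)) q.2) (P.prod (volume.restrict (Ioi 0))) := by
  have hexp : IntegrableOn (fun t : ℝ => Real.exp (-t ^ 2)) (Ioi 0) := by
    simpa using (integral_gaussian_moment 0 1).1
  have hS : MeasurableSet {q : Ω × ℝ | √(D q.1 * s / 4) < q.2} :=
    measurableSet_lt (by fun_prop) measurable_snd
  exact (hexp.comp_snd P).indicator hS

lemma erfc_sqrt_eq_integral (a : ℝ) :
    1 / 2 * erfc √a =
      1 / √Real.pi * ∫ t in Ioi (0 : ℝ), (Ioi √a).indicator (fun t => Real.exp (-t ^ 2)) t := by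
  rw [setIntegral_indicator measurableSet_Ioi,
    inter_eq_self_of_subset_right (Ioi_subset_Ioi (Real.sqrt_nonneg a)), erfc]
  ring

lemma integrable_half_erfc [IsProbabilityMeasure P] (hD : Measurable D) (s : ℝ) :
    Integrable (fun ω => 1 / 2 * erfc (√(D ω * s / 4))) P := by
  simp only [erfc_sqrt_eq_integral]
  exact (integrable_erfc_kernel hD s).integral_prod_left.const_mul _

/-- By Fubini's theorem the averaged pairwise error probability is a Gaussian average of the
distribution function of the squared distance. -/
lemma integral_half_erfc [IsProbabilityMeasure P] (hD : Measurable D) {s : ℝ} (hs : 0 < s) :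
    ∫ ω, 1 / 2 * erfc (√(D ω * s / 4)) ∂P =
      1 / √Real.pi * ∫ t in Ioi (0 : ℝ), Real.exp (-t ^ 2) * P.real {ω | D ω < 4 * t ^ 2 / s} := by
  simp only [erfc_sqrt_eq_integral]
  rw [integral_const_mul, integral_integral_swap (integrable_erfc_kernel hD s)]
  congr 1
  refine setIntegral_congr_fun measurableSet_Ioi fun t ht => ?_
  have hset : ∀ ω, (Ioi (√(D ω * s / 4))).indicator (fun t => Real.exp (-t ^ 2)) t =
      {ω | D ω < 4 * t ^ 2 / s}.indicator (fun _ => Real.exp (-t ^ 2)) ω := by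
    intro ω
    have hiff : √(D ω * s / 4) < t ↔ D ω < 4 * t ^ 2 / s := by
      rw [Real.sqrt_lt' ht, lt_div_iff₀ hs, div_lt_iff₀ (by norm_num), mul_comm 4]
    simp only [indicator, mem_Ioi, mem_ofPred_eq, hiff]
  simp only [hset]
  rw [integral_indicator_const _ (measurableSet_lt hD measurable_const), smul_eq_mul, mul_comm]

/-- The asymptotic constant of a single pair; `kLB` and `kUB` are its multiples by the weights of
the lower and upper bounds. -/
noncomputable def kPair (m : ℕ) : ℝ :=
  1 / 2 * (4 ^ m / √Real.pi) * (Real.Gamma ((m : ℝ) + 1 / 2) / Real.Gamma ((m : ℝ) + 1))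

lemma IsSmoothDensity.isBigO_integral_half_erfc [IsProbabilityMeasure P]
    (hf : IsSmoothDensity P D f) (hD : Measurable D) (N : ℕ) :
    (fun s : ℝ => ∫ ω, 1 / 2 * erfc (√(D ω * s / 4)) ∂P -
      ∑ n ∈ Finset.range (N + 1),
        1 / s ^ (n + 1) * kPair (n + 1) * iteratedDerivWithin n f (Ici 0) 0)
      =O[atTop] fun s : ℝ => 1 / s ^ (N + 2) := by
  obtain ⟨C, hC⟩ := hf.exists_cdf_bound hD N
  refine IsBigO.of_bound
    (1 / √Real.pi * (C * (4 ^ (N + 2) * (Real.Gamma (((N + 2 : ℕ) : ℝ) + 1 / 2) / 2)))) ?_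
  filter_upwards [eventually_gt_atTop 0] with s hs
  have hFint : IntegrableOn (fun t : ℝ => Real.exp (-t ^ 2) * P.real {ω | D ω < 4 * t ^ 2 / s})
      (Ioi 0) := by
    have hmono : Monotone fun u => P.real {ω | D ω < u} := fun u v huv =>
      measureReal_mono fun ω hω => lt_of_lt_of_le hω huv
    have hexp : IntegrableOn (fun t : ℝ => Real.exp (-t ^ 2)) (Ioi 0) := by
      simpa using (integral_gaussian_moment 0 1).1
    refine hexp.mul_bdd (c := 1) ?_ (ae_of_all _ fun t => ?_)
    · exact (hmono.measurable.comp (by fun_prop : Measurable fun t : ℝ =>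
        4 * t ^ 2 / s)).aestronglyMeasurable
    · rw [Real.norm_of_nonneg measureReal_nonneg]
      exact measureReal_le_one
  set G : ℝ → ℝ := fun t => ∑ n ∈ Finset.range (N + 1),
    iteratedDerivWithin n f (Ici 0) 0 / (n + 1).factorial *
      (Real.exp (-t ^ 2) * (4 * t ^ 2 / s) ^ (n + 1)) with hG
  have hGi : ∀ n ∈ Finset.range (N + 1), IntegrableOn (fun t : ℝ =>
      iteratedDerivWithin n f (Ici 0) 0 / (n + 1).factorial *
      (Real.exp (-t ^ 2) * (4 * t ^ 2 / s) ^ (n + 1))) (Ioi 0) := fun n _ =>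
    (integral_gaussian_moment (n + 1) s).1.const_mul _
  have hGint : IntegrableOn G (Ioi 0) := integrable_finsetSum _ hGi
  have hsum : ∑ n ∈ Finset.range (N + 1),
        1 / s ^ (n + 1) * kPair (n + 1) * iteratedDerivWithin n f (Ici 0) 0 =
      1 / √Real.pi * ∫ t in Ioi (0 : ℝ), G t := by
    rw [hG, integral_finsetSum _ hGi, Finset.mul_sum]
    refine Finset.sum_congr rfl fun n _ => ?_
    rw [integral_const_mul, (integral_gaussian_moment (n + 1) s).2, kPair,
      Real.Gamma_nat_eq_factorial]
    ring
  rw [integral_half_erfc hD hs, hsum, ← mul_sub, ← integral_sub hFint hGint, norm_mul,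
    Real.norm_of_nonneg (by positivity : 0 ≤ 1 / √Real.pi),
    Real.norm_of_nonneg (by positivity : 0 ≤ 1 / s ^ (N + 2)), mul_assoc]
  refine mul_le_mul_of_nonneg_left ?_ (by positivity)
  refine (norm_integral_le_of_norm_le ((integral_gaussian_moment (N + 2) s).1.const_mul C)
    ((ae_restrict_iff' measurableSet_Ioi).2 (ae_of_all _ fun t _ => ?_))).trans_eq ?_
  · have hfac : Real.exp (-t ^ 2) * P.real {ω | D ω < 4 * t ^ 2 / s} - G t =
        Real.exp (-t ^ 2) * (P.real {ω | D ω < 4 * t ^ 2 / s} -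
          ∑ n ∈ Finset.range (N + 1), iteratedDerivWithin n f (Ici 0) 0 / (n + 1).factorial *
            (4 * t ^ 2 / s) ^ (n + 1)) := by
      rw [hG, mul_sub, Finset.mul_sum]
      congr 1
      exact Finset.sum_congr rfl fun n _ => by ring
    rw [hfac, norm_mul, Real.norm_of_nonneg (Real.exp_pos _).le, mul_left_comm]
    exact mul_le_mul_of_nonneg_left (hC _ (by positivity)) (Real.exp_pos _).le
  · rw [integral_const_mul, (integral_gaussian_moment (N + 2) s).2]
    ring

end Density

/-! ### Diversity from an asymptotic expansion -/

/-- A function with an expansion in powers of `1 / s` has the order of its first nonzero term. -/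
lemma isTheta_of_expansion {A : ℝ → ℝ} {k S : ℕ → ℝ} (hk : ∀ n, k n ≠ 0)
    (hA : ∀ N : ℕ, (fun s : ℝ => A s - ∑ n ∈ Finset.range (N + 1),
      1 / s ^ (n + 1) * k (n + 1) * S n) =O[atTop] fun s : ℝ => 1 / s ^ (N + 2))
    (hS : ∃ n, S n ≠ 0) :
    A =Θ[atTop] fun s : ℝ => 1 / s ^ (1 + sInf {n : ℕ | S n ≠ 0}) := by
  set m := sInf {n : ℕ | S n ≠ 0} with hm
  have hSm : S m ≠ 0 := Nat.sInf_mem (s := {n : ℕ | S n ≠ 0}) hS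
  have hlt : ∀ n < m, S n = 0 := fun n hn => not_not.1 (Nat.notMem_of_lt_sInf hn)
  have hlead : ∀ s : ℝ, ∑ n ∈ Finset.range (m + 1), 1 / s ^ (n + 1) * k (n + 1) * S n =
      k (m + 1) * S m * (1 / s ^ (1 + m)) := by
    intro s
    rw [Finset.sum_range_succ, Finset.sum_eq_zero fun n hn => by
      rw [hlt n (Finset.mem_range.1 hn), mul_zero]]
    ring
  have hO := hA m
  simp only [hlead] at hO
  have hlittle : (fun s : ℝ => 1 / s ^ (m + 2)) =o[atTop] fun s : ℝ => 1 / s ^ (1 + m) := by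
    simp only [one_div]
    refine IsLittleO.inv_rev (isLittleO_pow_pow_atTop_of_lt (by omega)) ?_
    filter_upwards [eventually_gt_atTop 0] with s hs h
    exact absurd h (by positivity)
  have hc : k (m + 1) * S m ≠ 0 := mul_ne_zero (hk _) hSm
  have hmain : (fun s : ℝ => k (m + 1) * S m * (1 / s ^ (1 + m))) =Θ[atTop]
      fun s : ℝ => 1 / s ^ (1 + m) := (isTheta_const_mul_left hc).2 (isTheta_refl _ _)
  have := hmain.add_isLittleO (hO.trans_isLittleO hlittle)
  have hsplit : (fun s : ℝ => k (m + 1) * S m * (1 / s ^ (1 + m))) +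
      (fun s : ℝ => A s - k (m + 1) * S m * (1 / s ^ (1 + m))) = A :=
    funext fun s => add_sub_cancel _ _
  rwa [hsplit] at this

/-- Since `Real.log` is even, no sign condition on `A` is needed. -/
lemma tendsto_neg_log_div_log_of_isTheta {A : ℝ → ℝ} {d : ℕ}
    (hA : A =Θ[atTop] fun s : ℝ => 1 / s ^ d) :
    Tendsto (fun s : ℝ => -(Real.log (A s) / Real.log s)) atTop (𝓝 (d : ℝ)) := by
  obtain ⟨C, hC, hCA⟩ := hA.1.exists_pos
  obtain ⟨c, hc, hcA⟩ := hA.2.exists_pos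
  have hlog : Tendsto (fun s : ℝ => (Real.log s)⁻¹) atTop (𝓝 0) :=
    Real.tendsto_log_atTop.inv_tendsto_atTop
  -- `log |A s| = -d log s + O(1)`, and the bounded part is killed by `1 / log s`.
  have hlow : Tendsto (fun s : ℝ => d - Real.log C * (Real.log s)⁻¹) atTop (𝓝 (d : ℝ)) := by
    simpa using (hlog.const_mul (Real.log C)).const_sub (d : ℝ)
  have hup : Tendsto (fun s : ℝ => d + Real.log c * (Real.log s)⁻¹) atTop (𝓝 (d : ℝ)) := by
    simpa using (hlog.const_mul (Real.log c)).const_add (d : ℝ)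
  have hev : ∀ᶠ s : ℝ in atTop, d - Real.log C * (Real.log s)⁻¹ ≤
        -(Real.log (A s) / Real.log s) ∧
      -(Real.log (A s) / Real.log s) ≤ d + Real.log c * (Real.log s)⁻¹ := by
    filter_upwards [eventually_gt_atTop 1, hCA.bound, hcA.bound] with s hs h1 h2
    have hs0 : 0 < s := by linarith
    have hL : 0 < Real.log s := Real.log_pos hs
    have hpow : 0 < 1 / s ^ d := by positivity
    rw [Real.norm_of_nonneg hpow.le] at h1 h2
    have hApos : 0 < ‖A s‖ := pos_of_mul_pos_right (hpow.trans_le h2) hc.le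
    have e1 := Real.log_le_log hApos h1
    have e2 := Real.log_le_log hpow h2
    rw [Real.log_mul hC.ne' hpow.ne'] at e1
    rw [Real.log_mul hc.ne' hApos.ne'] at e2
    rw [Real.norm_eq_abs, Real.log_abs] at e1 e2
    rw [one_div, Real.log_inv, Real.log_pow] at e1 e2
    have hd : (d : ℝ) = d * Real.log s * (Real.log s)⁻¹ := by field_simp
    constructor
    · rw [hd, div_eq_mul_inv, ← sub_mul, ← neg_mul,]
      exact mul_le_mul_of_nonneg_right (by linarith) (by positivity)
    · rw [hd, div_eq_mul_inv, ← add_mul, ← neg_mul,]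
      exact mul_le_mul_of_nonneg_right (by linarith) (by positivity)
  exact tendsto_of_tendsto_of_tendsto_of_le_of_le' hlow hup
    (hev.mono fun _ h => h.1) (hev.mono fun _ h => h.2)

end MIMO

namespace MIMO

/-! ### Averaged bounds over the channel -/

section Average

variable {Ω : Type*} [MeasurableSpace Ω] {P : Measure Ω} {nr nt M : ℕ}
  {H : Ω → Matrix (Fin nr) (Fin nt) ℂ} {x : Fin M → Fin nt → ℂ}
  {xhat : ℝ → Matrix (Fin nr) (Fin nt) ℂ → (Fin nr → ℂ) → (Fin nt → ℂ)}
  {p : Fin M → Fin M → ℝ → ℝ}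

lemma integrable_pairSum [IsProbabilityMeasure P] (hH : Measurable H) (c s : ℝ) :
    Integrable (fun ω => c * ∑ i, ∑ j ∈ Finset.univ.filter (fun j => j ≠ i),
      1 / 2 * erfc (√(distSq x i j (H ω) * s / 4))) P :=
  (integrable_finsetSum _ fun i _ => integrable_finsetSum _ fun j _ =>
    integrable_half_erfc ((measurable_distSq x i j).comp hH) s).const_mul c

lemma integrable_errorProb [IsProbabilityMeasure P] (hH : Measurable H)
    (hx : IsMLDetector x xhat) {s : ℝ} (hs : 0 < s) :
    Integrable (fun ω => errorProb x xhat s (H ω)) P := by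
  refine Integrable.of_bound ((measurable_errorProb hx hs).comp hH).aestronglyMeasurable
    (∑ i : Fin M, 1 / (M : ℝ)) (ae_of_all _ fun ω => ?_)
  rw [Real.norm_of_nonneg (errorProb_nonneg _ _), errorProb_eq_sum hx hs, Finset.mul_sum]
  exact Finset.sum_le_sum fun i _ =>
    mul_le_of_le_one_right (by positivity) measureReal_le_one

/-- Almost surely no two symbols collide at the receiver. This discards the channels for which the
pairwise bounds fail because of ties. -/
lemma ae_distSq_pos (hH : Measurable H)
    (hp : ∀ i j, i ≠ j → IsSmoothDensity P (fun ω => distSq x i j (H ω)) (p i j)) :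
    ∀ᵐ ω ∂P, ∀ i j, i ≠ j → 0 < distSq x i j (H ω) := by
  simp only [ae_all_iff]
  exact fun i j hij => (hp i j hij).ae_pos ((measurable_distSq x i j).comp hH)

lemma avgErrorLB_le_avgErrorProb [IsProbabilityMeasure P] (hM : 2 ≤ M) (hH : Measurable H)
    (hx : IsMLDetector x xhat)
    (hp : ∀ i j, i ≠ j → IsSmoothDensity P (fun ω => distSq x i j (H ω)) (p i j))
    {s : ℝ} (hs : 0 < s) : avgErrorLB P H x s ≤ avgErrorProb P H x xhat s := by
  refine integral_mono_ae (integrable_pairSum hH _ s) (integrable_errorProb hH hx hs) ?_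
  filter_upwards [ae_distSq_pos hH hp] with ω hω
  exact errorLB_le_errorProb hx hM hs hω

lemma avgErrorProb_le_avgErrorUB [IsProbabilityMeasure P] (hH : Measurable H)
    (hx : IsMLDetector x xhat)
    (hp : ∀ i j, i ≠ j → IsSmoothDensity P (fun ω => distSq x i j (H ω)) (p i j))
    {s : ℝ} (hs : 0 < s) : avgErrorProb P H x xhat s ≤ avgErrorUB P H x s := by
  refine integral_mono_ae (integrable_errorProb hH hx hs) (integrable_pairSum hH _ s) ?_
  filter_upwards [ae_distSq_pos hH hp] with ω hω
  exact errorProb_le_errorUB hx hs hω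

lemma avgErrorLB_nonneg (hM : 2 ≤ M) (s : ℝ) : 0 ≤ avgErrorLB P H x s := by
  have hM2 : (2 : ℝ) ≤ M := by exact_mod_cast hM
  have hM1 : (0 : ℝ) ≤ M - 1 := by linarith
  have herfc : ∀ z, 0 ≤ erfc z := fun z =>
    mul_nonneg (by positivity) (integral_nonneg fun _ => (Real.exp_pos _).le)
  refine integral_nonneg fun ω => mul_nonneg (by positivity) ?_
  exact Finset.sum_nonneg fun i _ => Finset.sum_nonneg fun j _ =>
    mul_nonneg (by norm_num) (herfc _)

/-- The expansion of a weighted sum of all averaged pairwise error probabilities. -/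
lemma isBigO_integral_pairSum [IsProbabilityMeasure P] (hH : Measurable H)
    (hp : ∀ i j, i ≠ j → IsSmoothDensity P (fun ω => distSq x i j (H ω)) (p i j))
    (c : ℝ) (N : ℕ) :
    (fun s : ℝ => ∫ ω, c * ∑ i, ∑ j ∈ Finset.univ.filter (fun j => j ≠ i),
        1 / 2 * erfc (√(distSq x i j (H ω) * s / 4)) ∂P -
      ∑ n ∈ Finset.range (N + 1), 1 / s ^ (n + 1) * (c * kPair (n + 1)) * derivSum p n)
      =O[atTop] fun s : ℝ => 1 / s ^ (N + 2) := by
  have hD : ∀ i j, Measurable fun ω => distSq x i j (H ω) := fun i j =>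
    (measurable_distSq x i j).comp hH
  have hpair : ∀ i, ∀ j ∈ Finset.univ.filter (fun j => j ≠ i), _ := fun i j hj =>
    (hp i j (by simpa using hj : j ≠ i).symm).isBigO_integral_half_erfc (hD i j) N
  have hsum : (fun s : ℝ => c * (∑ i, ∑ j ∈ Finset.univ.filter (fun j => j ≠ i), fun s : ℝ =>
      ∫ ω, 1 / 2 * erfc (√(distSq x i j (H ω) * s / 4)) ∂P - ∑ n ∈ Finset.range (N + 1),
        1 / s ^ (n + 1) * kPair (n + 1) * iteratedDerivWithin n (p i j) (Ici 0) 0) s)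
      =O[atTop] fun s : ℝ => 1 / s ^ (N + 2) :=
    (IsBigO.sum fun i _ => IsBigO.sum (hpair i)).const_mul_left c
  refine hsum.congr_left fun s => ?_
  have hswap : ∑ n ∈ Finset.range (N + 1), 1 / s ^ (n + 1) * (c * kPair (n + 1)) * derivSum p n =
      c * ∑ i, ∑ j ∈ Finset.univ.filter (fun j => j ≠ i), ∑ n ∈ Finset.range (N + 1),
        1 / s ^ (n + 1) * kPair (n + 1) * iteratedDerivWithin n (p i j) (Ici 0) 0 := by
    simp only [derivSum, Finset.mul_sum]
    rw [Finset.sum_comm]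
    refine Finset.sum_congr rfl fun i _ => ?_
    rw [Finset.sum_comm]
    exact Finset.sum_congr rfl fun j _ => Finset.sum_congr rfl fun n _ => by ring
  rw [hswap, integral_const_mul, integral_finsetSum _ fun i _ => integrable_finsetSum _ fun j _ =>
    integrable_half_erfc (hD i j) s, ← mul_sub]
  simp only [integral_finsetSum _ fun j _ => integrable_half_erfc (hD _ j) s,
    Finset.sum_apply, Finset.sum_sub_distrib]

lemma kLB_eq (M m : ℕ) : kLB M m = 1 / ((M : ℝ) * ((M : ℝ) - 1)) * kPair m := by
  rw [kLB, kPair, mul_assoc (2 : ℝ), one_div, mul_inv]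
  ring

lemma kUB_eq (M m : ℕ) : kUB M m = 1 / (M : ℝ) * kPair m := by
  rw [kUB, kPair, one_div, mul_inv]
  ring

lemma kPair_pos (m : ℕ) : 0 < kPair m := by
  have h1 : 0 < Real.Gamma ((m : ℝ) + 1 / 2) := Real.Gamma_pos_of_pos (by positivity)
  have h2 : 0 < Real.Gamma ((m : ℝ) + 1) := Real.Gamma_pos_of_pos (by positivity)
  unfold kPair
  positivity

end Average

end MIMO

theorem lemma6 {Ω : Type*} [MeasurableSpace Ω] (P : Measure Ω) [IsProbabilityMeasure P]
    {nr nt M : ℕ} (hM : 2 ≤ M)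
    (H : Ω → Matrix (Fin nr) (Fin nt) ℂ) (hH : Measurable H)
    (x : Fin M → Fin nt → ℂ)
    (xhat : ℝ → Matrix (Fin nr) (Fin nt) ℂ → (Fin nr → ℂ) → (Fin nt → ℂ))
    (hxhat : MIMO.IsMLDetector x xhat)
    (p : Fin M → Fin M → ℝ → ℝ)
    (hp : ∀ i j, i ≠ j → MIMO.IsSmoothDensity P (fun ω => MIMO.distSq x i j (H ω)) (p i j)) :
    (∀ snr : ℝ, 0 < snr →
      MIMO.avgErrorLB P H x snr ≤ MIMO.avgErrorProb P H x xhat snr ∧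
        MIMO.avgErrorProb P H x xhat snr ≤ MIMO.avgErrorUB P H x snr) ∧
    (∀ N : ℕ,
      (fun snr : ℝ => MIMO.avgErrorLB P H x snr -
          ∑ n ∈ Finset.range (N + 1),
            1 / snr ^ (n + 1) * MIMO.kLB M (n + 1) * MIMO.derivSum p n)
        =O[atTop] fun snr : ℝ => 1 / snr ^ (N + 2)) ∧
    (∀ N : ℕ,
      (fun snr : ℝ => MIMO.avgErrorUB P H x snr -
          ∑ n ∈ Finset.range (N + 1),
            1 / snr ^ (n + 1) * MIMO.kUB M (n + 1) * MIMO.derivSum p n)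
        =O[atTop] fun snr : ℝ => 1 / snr ^ (N + 2)) ∧
    ((∃ n : ℕ, MIMO.derivSum p n ≠ 0) →
      (MIMO.avgErrorProb P H x xhat =O[atTop] fun snr : ℝ => 1 / snr ^ MIMO.diversity p) ∧
      (¬ MIMO.avgErrorProb P H x xhat =o[atTop] fun snr : ℝ => 1 / snr ^ MIMO.diversity p) ∧
      (MIMO.avgErrorProb P H x xhat =Θ[atTop] fun snr : ℝ => 1 / snr ^ MIMO.diversity p) ∧
      Tendsto (fun snr : ℝ => -(Real.log (MIMO.avgErrorProb P H x xhat snr) / Real.log snr))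
        atTop (𝓝 (MIMO.diversity p : ℝ))) := by
  have hM2 : (2 : ℝ) ≤ M := by exact_mod_cast hM
  have hM1 : (0 : ℝ) < M - 1 := by linarith
  have hM0 : (0 : ℝ) < M := by linarith
  have hLB : ∀ N : ℕ, (fun snr : ℝ => MIMO.avgErrorLB P H x snr -
      ∑ n ∈ Finset.range (N + 1), 1 / snr ^ (n + 1) * MIMO.kLB M (n + 1) * MIMO.derivSum p n)
        =O[atTop] fun snr : ℝ => 1 / snr ^ (N + 2) := by
    simp only [MIMO.kLB_eq]
    exact MIMO.isBigO_integral_pairSum hH hp _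
  have hUB : ∀ N : ℕ, (fun snr : ℝ => MIMO.avgErrorUB P H x snr -
      ∑ n ∈ Finset.range (N + 1), 1 / snr ^ (n + 1) * MIMO.kUB M (n + 1) * MIMO.derivSum p n)
        =O[atTop] fun snr : ℝ => 1 / snr ^ (N + 2) := by
    simp only [MIMO.kUB_eq]
    exact MIMO.isBigO_integral_pairSum hH hp _
  refine ⟨fun snr hs => ⟨MIMO.avgErrorLB_le_avgErrorProb hM hH hxhat hp hs,
    MIMO.avgErrorProb_le_avgErrorUB hH hxhat hp hs⟩, hLB, hUB, fun hS => ?_⟩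
  have hkLB : ∀ n, MIMO.kLB M n ≠ 0 := fun n => by
    rw [MIMO.kLB_eq]
    exact (mul_pos (by positivity) (MIMO.kPair_pos n)).ne'
  have hkUB : ∀ n, MIMO.kUB M n ≠ 0 := fun n => by
    rw [MIMO.kUB_eq]
    exact (mul_pos (by positivity) (MIMO.kPair_pos n)).ne'
  have hΘLB := MIMO.isTheta_of_expansion hkLB hLB hS
  have hΘUB := MIMO.isTheta_of_expansion hkUB hUB hS
  have hΘ : MIMO.avgErrorProb P H x xhat =Θ[atTop]
      fun snr : ℝ => 1 / snr ^ MIMO.diversity p := by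
    constructor
    · refine IsBigO.trans (IsBigO.of_bound' ?_) hΘUB.1
      filter_upwards [eventually_gt_atTop 0] with s hs
      have h1 := MIMO.avgErrorProb_le_avgErrorUB hH hxhat hp hs
      have h0 := (MIMO.avgErrorLB_nonneg hM s).trans
        (MIMO.avgErrorLB_le_avgErrorProb hM hH hxhat hp hs)
      rwa [Real.norm_of_nonneg h0, Real.norm_of_nonneg (h0.trans h1)]
    · refine IsBigO.trans hΘLB.2 (IsBigO.of_bound' ?_)
      filter_upwards [eventually_gt_atTop 0] with s hs
      have h0 : 0 ≤ MIMO.avgErrorLB P H x s := MIMO.avgErrorLB_nonneg hM s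
      have h1 := MIMO.avgErrorLB_le_avgErrorProb hM hH hxhat hp hs
      rwa [Real.norm_of_nonneg h0, Real.norm_of_nonneg (h0.trans h1)]
  refine ⟨hΘ.1, fun ho => ?_, hΘ, MIMO.tendsto_neg_log_div_log_of_isTheta hΘ⟩
  -- `o` and `Ω` together would make `1 / snr ^ d` negligible against itself.
  refine (hΘ.2.trans_isLittleO ho).not_isBigO ?_ (isBigO_refl _ _)
  refine Eventually.frequently ?_
  filter_upwards [eventually_gt_atTop 0] with s hs
  positivity
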